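/- Let $X$ be a metric space. A ball of $X$ is a pair consisting of a center $x\in X$ and a radius $r>0$, with associated open ball $B(x,r)=\{y:d(x,y)<r\}$ and closed ball $\overline B(x,r)=\{y:d(x,y)\le r\}$; balls with different centers or radii are regarded as different even if they coincide as sets. A gauge function $\xi$ assigns to each ball a number $\xi(B(x,r))=\xi(\overline B(x,r))\in(0,\infty)$. It is $D$-doubling if $D^{-1}\xi(B)\le\xi(B')\le D\,\xi(B)$ for all open balls $B\subset B'$ with $\mathrm{rad}(B)\le\mathrm{rad}(B')\le 2\,\mathrm{rad}(B)$. For $A\subset X$ and $r>0$ let $$\mathcal H^\xi_r(A)=\inf\Big\{\sum_{c\in\mathcal C}\xi(c):\ \mathcal C\text{ a collection of open balls of radius}\le r,\ A\subset\bigcup\mathcal C\Big\}\in[0,\infty]$$ (with $\inf\emptyset=\infty$). For a collection $\mathcal B$ of closed balls put $\mathcal B|_r^A=\{\overline B\in\mathcal B:\mathrm{rad}(\overline B)\le r,\ \overline B\subset A\}$, and let $\limsup\mathcal B$ be the set of points that lie in infinitely many distinct balls $\overline B_i\in\mathcal B$, $i\in\mathbb N$, with $\lim_{i\to\infty}\mathrm{rad}(\overline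 B_i)=0$. Write $\tfrac12\overline B(x,r)=\overline B(x,r/2)$. **Theorem.** For every $D$ there is a constant $\beta=\beta(D)>0$ such that the following holds for every $\Delta\in(0,1)$. Let $X$ be a complete metric space, $\xi$ a $D$-doubling gauge function on $X$, and $\mathcal B$ a collection of closed balls of $X$ such that for each $\overline B_0=\overline B(x_0,r_0)\in\mathcal B$ and every $r\in(0,r_0]$ $$\mathcal H^\xi_{r_0}\Big(\bigcup\mathcal B|_r^{\frac12\overline B_0}\Big)\ \ge\ \Delta\,\xi(\overline B_0).$$ Then for each $\overline B_0=\overline B(x_0,r_0)\in\mathcal B$ $$\mathcal H^\xi_{r_0}\big(\limsup\mathcal B|_{r_0}^{\overline B_0}\big)\ \ge\ \Delta\,\beta\,\xi(\overline B_0).$$ -/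

import Mathlib

open Set Filter Topology
open scoped ENNReal

universe u

/-- A ball of a metric space is a center together with a positive radius: two balls that coincide
as sets but differ in center or radius are different balls. The same pair `(x, r)` stands for the
open ball `B(x, r)` and for the closed ball `{y | d(y, x) ≤ r}`. -/
@[ext]
structure MBall (X : Type u) where
  center : X
  radius : ℝ
  radius_pos : 0 < radius

namespace MBall

variable {X : Type u} [MetricSpace X]

/-- The open ball as a set. -/
def openSet (B : MBall X) : Set X := Metric.ball B.center B.radius

/-- The closed ball as a set (not the closure of the open ball). -/
def closedSet (B : MBall X) : Set X := Metric.closedBall B.center B.radius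

/-- The closed ball with the same center and radius multiplied by `t`, as a set. -/
def scaledClosedSet (t : ℝ) (B : MBall X) : Set X := Metric.closedBall B.center (t * B.radius)

end MBall

/-- `ξ` is a `D`-doubling gauge function. A gauge takes the same value on the open and the closed
ball with a given center and radius, so it is a positive function of the pair. -/
structure IsDoublingGauge {X : Type u} [MetricSpace X] (D : ℝ) (ξ : MBall X → ℝ) : Prop where
  pos : ∀ B, 0 < ξ B
  doubling : ∀ B B' : MBall X, B.openSet ⊆ B'.openSet →
    B.radius ≤ B'.radius → B'.radius ≤ 2 * B.radius →
    D⁻¹ * ξ B ≤ ξ B' ∧ ξ B' ≤ D * ξ B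

/-- The spherical Hausdorff `ξ`-content at scale `r`: the infimum of `∑_{c ∈ 𝒞} ξ(c)` over the
collections `𝒞` of open balls of radius at most `r` that cover `A`. -/
noncomputable def hausdorffContent {X : Type u} [MetricSpace X] (ξ : MBall X → ℝ) (r : ℝ)
    (A : Set X) : ℝ≥0∞ :=
  sInf {s : ℝ≥0∞ | ∃ 𝒞 : Set (MBall X), (∀ c ∈ 𝒞, c.radius ≤ r) ∧ A ⊆ (⋃ c ∈ 𝒞, c.openSet) ∧
    s = ∑' c : 𝒞, ENNReal.ofReal (ξ c)}

/-- The subcollection of the closed balls of `𝓑` of radius at most `r` that are contained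
in `A`. -/
def restrictBalls {X : Type u} [MetricSpace X] (𝓑 : Set (MBall X)) (r : ℝ) (A : Set X) :
    Set (MBall X) :=
  {B | B ∈ 𝓑 ∧ B.radius ≤ r ∧ B.closedSet ⊆ A}

/-- The union of a collection of closed balls. -/
def unionBalls {X : Type u} [MetricSpace X] (𝓑 : Set (MBall X)) : Set X :=
  ⋃ B ∈ 𝓑, B.closedSet

/-- The limsup set of a collection of closed balls: the points that lie in infinitely many
distinct balls `B_i` of the collection with `rad B_i → 0`. -/
def limsupBalls {X : Type u} [MetricSpace X] (𝓑 : Set (MBall X)) : Set X :=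
  {x | ∃ B : ℕ → MBall X, Function.Injective B ∧ (∀ i, B i ∈ 𝓑) ∧ (∀ i, x ∈ (B i).closedSet) ∧
    Tendsto (fun i => (B i).radius) atTop (𝓝 0)}

/-! Argue by contradiction. Suppose a cover `𝒞` of the limsup set costs less than `τ ξ(B₀)`, where
`τ = Δβ`. Then `B₀` is sparsely covered by `𝒞`, and sparsity passes to ever smaller nested balls of
`𝓑` (`SparselyCovered.exists_smaller`). By completeness these shrink to a point of the limsup set. A
ball of `𝒞` containing it meets every half ball, so by sparsity its radius is at most radii tending
to `0`: impossible.

If sparsity did not pass on, each tiny `B' ∈ 𝓑` in half of `B` would either lie in the enlargement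
of a relatively large `c ∈ 𝒞`, or contain small balls of `𝒞` of total gauge at least `τ ξ(B')`. The
first kind is cheap because `B` is sparse. The second is cheap by Vitali and disjointness, since it
is paid for by a tail of a convergent sum. Together they cost less than `Δ ξ(B)`, against the
content hypothesis. -/

namespace MBall

variable {X : Type u} [MetricSpace X]

/-- The ball with the same center and the radius multiplied by `t`. -/
def scale (t : ℝ) (ht : 0 < t) (B : MBall X) : MBall X :=
  ⟨B.center, t * B.radius, mul_pos ht B.radius_pos⟩

/-- The balls of `𝒞` that meet the closed ball `B` scaled by one half. -/
def meetingHalf (𝒞 : Set (MBall X)) (B : MBall X) : Set (MBall X) :=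
  {c | c ∈ 𝒞 ∧ (c.openSet ∩ B.scaledClosedSet (1 / 2)).Nonempty}

theorem dist_center_lt_of_meets {c B : MBall X}
    (h : (c.openSet ∩ B.scaledClosedSet (1 / 2)).Nonempty) :
    dist B.center c.center < c.radius + B.radius / 2 := by
  obtain ⟨y, hyc, hyB⟩ := h
  simp only [openSet, scaledClosedSet, Metric.mem_ball, Metric.mem_closedBall] at hyc hyB
  have := dist_triangle_left B.center c.center y
  linarith

theorem closedSet_subset_scale_of_meets {c B : MBall X}
    (h : (c.openSet ∩ B.scaledClosedSet (1 / 2)).Nonempty) (hr : B.radius / 4 < c.radius) :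
    B.closedSet ⊆ (c.scale 16 (by norm_num)).openSet := by
  intro y hy
  have h₁ := dist_center_lt_of_meets h
  simp only [openSet, closedSet, scale, Metric.mem_ball, Metric.mem_closedBall] at hy ⊢
  have := dist_triangle y B.center c.center
  linarith [c.radius_pos]

/-- The threshold 1/4 is what the triangle inequality needs: 1/4 + 1/4 + 1/2 = 1. -/
theorem openSet_subset_closedSet_of_meets {c B : MBall X}
    (h : (c.openSet ∩ B.scaledClosedSet (1 / 2)).Nonempty) (hr : c.radius ≤ B.radius / 4) :
    c.openSet ⊆ B.closedSet := by
  intro y hy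
  have h₁ := dist_center_lt_of_meets h
  simp only [openSet, closedSet, Metric.mem_ball, Metric.mem_closedBall] at hy ⊢
  have := dist_triangle_right y B.center c.center
  linarith

theorem scaledClosedSet_half_subset (B : MBall X) : B.scaledClosedSet (1 / 2) ⊆ B.closedSet :=
  Metric.closedBall_subset_closedBall (by linarith [B.radius_pos])

theorem meetingHalf_mono (𝒞 : Set (MBall X)) {B B' : MBall X}
    (h : B'.closedSet ⊆ B.scaledClosedSet (1 / 2)) : meetingHalf 𝒞 B' ⊆ meetingHalf 𝒞 B :=
  fun _ hc => ⟨hc.1, hc.2.mono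
    (inter_subset_inter_right _ (B'.scaledClosedSet_half_subset.trans h))⟩

end MBall

/-! ### Comparing gauges of nearby balls -/

namespace IsDoublingGauge

variable {X : Type u} [MetricSpace X] {D : ℝ} {ξ : MBall X → ℝ}

theorem one_le (hξ : IsDoublingGauge D ξ) (B : MBall X) : 1 ≤ D := by
  have h := (hξ.doubling B B Subset.rfl le_rfl (by linarith [B.radius_pos])).2
  exact le_of_mul_le_mul_right (by simpa using h) (hξ.pos B)

theorem le_mul_of_subset (hξ : IsDoublingGauge D ξ) {B B' : MBall X}
    (h : B.openSet ⊆ B'.openSet) (h₁ : B.radius ≤ B'.radius) (h₂ : B'.radius ≤ 2 * B.radius) :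
    ξ B ≤ D * ξ B' := by
  have hD : 0 < D := lt_of_lt_of_le one_pos (hξ.one_le B)
  exact (inv_mul_le_iff₀ hD).1 (hξ.doubling B B' h h₁ h₂).1

theorem concentric_le (hξ : IsDoublingGauge D ξ) (x : X) (k : ℕ) {s t : ℝ} (hs : 0 < s)
    (ht : 0 < t) (hst : s ≤ t) (hts : t ≤ 2 ^ k * s) : ξ ⟨x, t, ht⟩ ≤ D ^ k * ξ ⟨x, s, hs⟩ := by
  have hD := hξ.one_le ⟨x, s, hs⟩
  induction k generalizing t with
  | zero =>
    obtain rfl : s = t := le_antisymm hst (by simpa using hts)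
    simp
  | succ k ih =>
    -- Halve the radius, but never below `s`, so that each comparison has ratio at most 2.
    have hu : 0 < max s (t / 2) := lt_max_of_lt_left hs
    have hk : (1 : ℝ) ≤ 2 ^ k := one_le_pow₀ (by norm_num)
    have h₁ := ih hu (le_max_left _ _)
      (max_le (by nlinarith) (by rw [pow_succ] at hts; linarith))
    have hut : max s (t / 2) ≤ t := max_le hst (by linarith)
    have h₂ := (hξ.doubling ⟨x, max s (t / 2), hu⟩ ⟨x, t, ht⟩
      (Metric.ball_subset_ball hut) hut
      (by simpa using (by linarith [le_max_right s (t / 2)] : t ≤ 2 * max s (t / 2)))).2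
    calc ξ ⟨x, t, ht⟩ ≤ D * ξ ⟨x, max s (t / 2), hu⟩ := h₂
      _ ≤ D * (D ^ k * ξ ⟨x, s, hs⟩) := mul_le_mul_of_nonneg_left h₁ (by linarith)
      _ = D ^ (k + 1) * ξ ⟨x, s, hs⟩ := by ring

theorem scale_le (hξ : IsDoublingGauge D ξ) (B : MBall X) (k : ℕ) {t : ℝ} (h1 : 1 ≤ t)
    (ht : t ≤ 2 ^ k) : ξ (B.scale t (one_pos.trans_le h1)) ≤ D ^ k * ξ B :=
  hξ.concentric_le B.center k B.radius_pos _ (by nlinarith [B.radius_pos])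
    (mul_le_mul_of_nonneg_right ht B.radius_pos.le)

theorem le_of_meets (hξ : IsDoublingGauge D ξ) {c B : MBall X}
    (h : (c.openSet ∩ B.scaledClosedSet (1 / 2)).Nonempty) (h₁ : c.radius ≤ B.radius)
    (h₂ : B.radius / 16 < c.radius) : ξ B ≤ D ^ 8 * ξ c := by
  have hD : 0 < D := lt_of_lt_of_le one_pos (hξ.one_le B)
  have hd := MBall.dist_center_lt_of_meets h
  have hB := B.radius_pos
  -- The centers are less than 3/2 `B.radius` apart, so twice `B` lies in the ball of radius `4 *
  -- B.radius` about `c.center`, and that radius is below `2 ^ 6 * c.radius`.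
  have h4 : 0 < 4 * B.radius := by linarith
  have e₁ : ξ B ≤ D * ξ (B.scale 2 two_pos) :=
    hξ.le_mul_of_subset (Metric.ball_subset_ball (by simp only [MBall.scale]; linarith))
      (by simp only [MBall.scale]; linarith) le_rfl
  have e₂ : ξ (B.scale 2 two_pos) ≤ D * ξ ⟨c.center, 4 * B.radius, h4⟩ :=
    hξ.le_mul_of_subset
      (Metric.ball_subset_ball' (by simp only [MBall.scale]; linarith))
      (by simp only [MBall.scale]; linarith) (by simp only [MBall.scale]; linarith)
  have e₃ : ξ ⟨c.center, 4 * B.radius, h4⟩ ≤ D ^ 6 * ξ c :=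
    hξ.concentric_le c.center 6 c.radius_pos h4 (by linarith) (by linarith)
  calc ξ B ≤ D * (D * (D ^ 6 * ξ c)) := by
        refine e₁.trans (mul_le_mul_of_nonneg_left (e₂.trans ?_) hD.le)
        exact mul_le_mul_of_nonneg_left e₃ hD.le
    _ = D ^ 8 * ξ c := by ring

end IsDoublingGauge

/-- In a summable collection of balls, the balls of small radius contribute little. -/
theorem exists_tsum_small_radius_le {X : Type u} {w : MBall X → ℝ≥0∞} {𝒞 : Set (MBall X)}
    (h : ∑' c : 𝒞, w c ≠ ∞) {ε : ℝ≥0∞} (hε : 0 < ε) :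
    ∃ r : ℝ, 0 < r ∧ ∑' c : {c | c ∈ 𝒞 ∧ c.radius ≤ r}, w c ≤ ε := by
  obtain ⟨F, hF⟩ := ((ENNReal.tendsto_tsum_compl_atTop_zero h).eventually
    (Iic_mem_nhds hε)).exists
  -- Finitely many balls carry all but `ε` of the sum; take `r` below all their radii.
  obtain ⟨r, hr, hrF⟩ : ∃ r : ℝ, 0 < r ∧ ∀ c ∈ F, r < c.1.radius := by
    have : ∀ᶠ r in 𝓝[>] (0 : ℝ), ∀ c ∈ F, r < c.1.radius :=
      (Filter.eventually_all_finset F).2 fun c _ =>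
        nhdsWithin_le_nhds (Iio_mem_nhds c.1.radius_pos)
    exact (eventually_mem_nhdsWithin.and this).exists
  refine ⟨r, hr, le_trans ?_ hF⟩
  let φ : {c | c ∈ 𝒞 ∧ c.radius ≤ r} → {x : 𝒞 // x ∉ F} :=
    fun c => ⟨⟨c.1, c.2.1⟩, fun hc => absurd (hrF _ hc) (not_lt.2 c.2.2)⟩
  have hφ : Function.Injective φ := fun a b hab => by
    simpa [φ, Subtype.ext_iff] using hab
  exact ENNReal.tsum_comp_le_tsum_of_injective hφ (fun x => w x.1.1)

/-! ### Content estimates and descent to smaller balls -/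

section Content

variable {X : Type u} [MetricSpace X]

theorem hausdorffContent_le_tsum_add_tsum (ξ : MBall X → ℝ) {r : ℝ} {A : Set X}
    {ι κ : Type*} (f : ι → MBall X) (g : κ → MBall X) (hf : ∀ i, (f i).radius ≤ r)
    (hg : ∀ j, (g j).radius ≤ r)
    (hA : ∀ x ∈ A, (∃ i, x ∈ (f i).openSet) ∨ ∃ j, x ∈ (g j).openSet) :
    hausdorffContent ξ r A ≤
      ∑' i, ENNReal.ofReal (ξ (f i)) + ∑' j, ENNReal.ofReal (ξ (g j)) := by
  calc hausdorffContent ξ r A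
      ≤ ∑' c : ↑(range f ∪ range g), ENNReal.ofReal (ξ c) := by
        refine sInf_le ⟨range f ∪ range g, ?_, ?_, rfl⟩
        · rintro c (⟨i, rfl⟩ | ⟨j, rfl⟩)
          exacts [hf i, hg j]
        · intro x hx
          rcases hA x hx with ⟨i, hi⟩ | ⟨j, hj⟩
          · exact mem_biUnion (Or.inl (mem_range_self i)) hi
          · exact mem_biUnion (Or.inr (mem_range_self j)) hj
    _ ≤ ∑' c : range f, ENNReal.ofReal (ξ c) + ∑' c : range g, ENNReal.ofReal (ξ c) :=
        ENNReal.tsum_union_le (fun c => ENNReal.ofReal (ξ c)) _ _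
    _ ≤ _ := add_le_add
        (ENNReal.tsum_le_tsum_comp_of_surjective rangeFactorization_surjective
          (fun c : range f => ENNReal.ofReal (ξ c)))
        (ENNReal.tsum_le_tsum_comp_of_surjective rangeFactorization_surjective
          (fun c : range g => ENNReal.ofReal (ξ c)))

/-- `B` is sparsely covered by `𝒞`: the members of `𝒞` meeting half of `B` are no larger than `B`
and have total gauge at most `τ ξ(B)`. -/
def SparselyCovered (ξ : MBall X → ℝ) (𝒞 : Set (MBall X)) (τ : ℝ) (B : MBall X) : Prop :=
  (∀ c ∈ B.meetingHalf 𝒞, c.radius ≤ B.radius) ∧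
    ∑' c : B.meetingHalf 𝒞, ENNReal.ofReal (ξ c) ≤ ENNReal.ofReal (τ * ξ B)

/-- Disjoint balls that carry at least the proportion `τ` of small balls of `𝒞` have, even after
enlargement, total gauge controlled by that of the small balls. -/
theorem tsum_scale_le_of_disjoint {D τ r : ℝ} {ξ : MBall X → ℝ} (hξ : IsDoublingGauge D ξ)
    (hD : 1 ≤ D) (hτ : 0 < τ) {𝒞 u : Set (MBall X)}
    (hu : u.PairwiseDisjoint fun B => Metric.closedBall B.center B.radius)
    (hr : ∀ B ∈ u, B.radius ≤ r)
    (hsmall : ∀ B ∈ u, ∀ c ∈ B.meetingHalf 𝒞, c.radius ≤ B.radius / 4)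
    (hmass : ∀ B ∈ u,
      ENNReal.ofReal (τ * ξ B) ≤ ∑' c : B.meetingHalf 𝒞, ENNReal.ofReal (ξ c)) :
    ∑' B : u, ENNReal.ofReal (ξ (B.1.scale 8 (by norm_num))) ≤
      ENNReal.ofReal (D ^ 3 / τ) *
        ∑' c : {c | c ∈ 𝒞 ∧ c.radius ≤ r}, ENNReal.ofReal (ξ c) := by
  -- A small ball meeting half of `B` lies inside `B`, so no ball of `𝒞` is counted twice.
  have hdisj : u.PairwiseDisjoint fun B => B.meetingHalf 𝒞 := by
    intro B hB B' hB' hne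
    refine Set.disjoint_left.2 fun c hc hc' => ?_
    have hcc : c.center ∈ c.openSet := Metric.mem_ball_self c.radius_pos
    exact Set.disjoint_left.1 (hu hB hB' hne)
      (MBall.openSet_subset_closedSet_of_meets hc.2 (hsmall B hB c hc) hcc)
      (MBall.openSet_subset_closedSet_of_meets hc'.2 (hsmall B' hB' c hc') hcc)
  calc ∑' B : u, ENNReal.ofReal (ξ (B.1.scale 8 (by norm_num)))
      ≤ ∑' B : u, ENNReal.ofReal (D ^ 3 / τ) *
          ∑' c : B.1.meetingHalf 𝒞, ENNReal.ofReal (ξ c) := by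
        refine ENNReal.tsum_le_tsum fun B => ?_
        calc ENNReal.ofReal (ξ (B.1.scale 8 (by norm_num)))
            ≤ ENNReal.ofReal (D ^ 3 / τ * (τ * ξ B.1)) := by
              refine ENNReal.ofReal_le_ofReal ?_
              rw [← mul_assoc, div_mul_cancel₀ _ hτ.ne']
              exact hξ.scale_le B.1 3 (by norm_num) (by norm_num)
          _ = ENNReal.ofReal (D ^ 3 / τ) * ENNReal.ofReal (τ * ξ B.1) :=
              ENNReal.ofReal_mul (by positivity)
          _ ≤ _ := by gcongr; exact hmass B.1 B.2
    _ = ENNReal.ofReal (D ^ 3 / τ) *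
          ∑' c : ⋃ B ∈ u, B.meetingHalf 𝒞, ENNReal.ofReal (ξ c) := by
        rw [ENNReal.tsum_mul_left,
          ENNReal.tsum_biUnion' (f := fun c => ENNReal.ofReal (ξ c)) hdisj]
    _ ≤ _ := by
        gcongr
        refine ENNReal.tsum_mono_subtype (fun c => ENNReal.ofReal (ξ c)) ?_
        refine iUnion₂_subset fun B hB c hc => ⟨hc.1, ?_⟩
        linarith [hsmall B hB c hc, hr B hB, B.radius_pos]

/-- A sparsely covered ball whose half contains much of the collection at all scales contains a
much smaller sparsely covered ball of the collection. -/
theorem SparselyCovered.exists_smaller {D Δ τ : ℝ} {ξ : MBall X → ℝ} (hξ : IsDoublingGauge D ξ)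
    (hΔ : 0 < Δ) (hΔ1 : Δ < 1) (hτ : 0 < τ) (hτD : D ^ 8 * τ ≤ Δ / 2) {𝓑 𝒞 : Set (MBall X)}
    (h𝒞 : ∑' c : 𝒞, ENNReal.ofReal (ξ c) ≠ ∞) {B : MBall X}
    (hcontent : ∀ r : ℝ, 0 < r → r ≤ B.radius → ENNReal.ofReal (Δ * ξ B) ≤
      hausdorffContent ξ B.radius (unionBalls (restrictBalls 𝓑 r (B.scaledClosedSet (1 / 2)))))
    (hB : SparselyCovered ξ 𝒞 τ B) :
    ∃ B' ∈ 𝓑, B'.closedSet ⊆ B.scaledClosedSet (1 / 2) ∧ B'.radius ≤ B.radius / 2 ∧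
      SparselyCovered ξ 𝒞 τ B' := by
  have hD := hξ.one_le B
  have hξB := hξ.pos B
  have hBr := B.radius_pos
  -- A larger `c` would alone exceed the budget `τ ξ(B)`. The bound makes the enlargements by 16
  -- admissible for the content at scale `B.radius`.
  have hbig : ∀ c ∈ B.meetingHalf 𝒞, 16 * c.radius ≤ B.radius := by
    intro c hc
    by_contra! hlt
    have h₁ := hξ.le_of_meets hc.2 (hB.1 c hc) (by linarith)
    have h₂ : ENNReal.ofReal (ξ c) ≤ ENNReal.ofReal (τ * ξ B) :=
      (ENNReal.le_tsum (f := fun c : B.meetingHalf 𝒞 => ENNReal.ofReal (ξ c)) ⟨c, hc⟩).trans hB.2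
    rw [ENNReal.ofReal_le_ofReal_iff (by positivity)] at h₂
    have h₃ : D ^ 8 * ξ c ≤ D ^ 8 * (τ * ξ B) := by gcongr
    have h₄ : D ^ 8 * τ * ξ B ≤ Δ / 2 * ξ B := by gcongr
    nlinarith
  -- Chosen so that the enlarged Vitali balls cost at most `D ^ 3 / τ * η = Δ * ξ B / 4`.
  set η : ℝ := Δ * τ * ξ B / (4 * D ^ 3) with hη
  have hηpos : 0 < η := by positivity
  obtain ⟨r₁, hr₁, htail⟩ := exists_tsum_small_radius_le
    (w := fun c => ENNReal.ofReal (ξ c)) h𝒞 (ENNReal.ofReal_pos.2 hηpos)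
  set r := min r₁ (B.radius / 8) with hrdef
  have hr : 0 < r := lt_min hr₁ (by linarith)
  have hr8 : r ≤ B.radius / 8 := min_le_right _ _
  by_contra! hno
  let t : Set (MBall X) := {B' | B' ∈ restrictBalls 𝓑 r (B.scaledClosedSet (1 / 2)) ∧
    ∀ c ∈ B'.meetingHalf 𝒞, c.radius ≤ B'.radius / 4}
  obtain ⟨u, hut, hudisj, hucov⟩ :=
    Vitali.exists_disjoint_subfamily_covering_enlargement_closedBall t MBall.center MBall.radius r
      (fun a ha => ha.1.2.1) 5 (by norm_num)
  have hmass : ∀ B' ∈ u,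
      ENNReal.ofReal (τ * ξ B') ≤ ∑' c : B'.meetingHalf 𝒞, ENNReal.ofReal (ξ c) := by
    intro B' hB'
    obtain ⟨⟨h𝓑, hrad, hsub⟩, hsm⟩ := hut hB'
    by_contra! hlt
    exact hno B' h𝓑 hsub (by linarith)
      ⟨fun c hc => by linarith [hsm c hc, B'.radius_pos], hlt.le⟩
  have hcover := hausdorffContent_le_tsum_add_tsum ξ (r := B.radius)
    (A := unionBalls (restrictBalls 𝓑 r (B.scaledClosedSet (1 / 2))))
    (fun c : B.meetingHalf 𝒞 => c.1.scale 16 (by norm_num))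
    (fun B' : u => B'.1.scale 8 (by norm_num))
    (fun c => hbig c.1 c.2)
    (fun B' => by
      have := (hut B'.2).1.2.1
      simp only [MBall.scale]; linarith)
    (by
      intro x hx
      obtain ⟨B', hB', hxB'⟩ := mem_iUnion₂.1 hx
      by_cases hsm : ∀ c ∈ B'.meetingHalf 𝒞, c.radius ≤ B'.radius / 4
      · obtain ⟨b, hbu, hb⟩ := hucov B' ⟨hB', hsm⟩
        refine Or.inr ⟨⟨b, hbu⟩, Metric.closedBall_subset_ball ?_ (hb hxB')⟩
        simp only [MBall.scale]; linarith [b.radius_pos]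
      · push Not at hsm
        obtain ⟨c, hc, hlt⟩ := hsm
        exact Or.inl ⟨⟨c, MBall.meetingHalf_mono 𝒞 hB'.2.2 hc⟩,
          MBall.closedSet_subset_scale_of_meets hc.2 hlt hxB'⟩)
  have hsum₁ : ∑' c : B.meetingHalf 𝒞, ENNReal.ofReal (ξ (c.1.scale 16 (by norm_num))) ≤
      ENNReal.ofReal (D ^ 4 * (τ * ξ B)) := by
    rw [ENNReal.ofReal_mul (by positivity)]
    refine le_trans ?_ (mul_le_mul_right hB.2 _)
    rw [← ENNReal.tsum_mul_left]
    refine ENNReal.tsum_le_tsum fun c => ?_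
    rw [← ENNReal.ofReal_mul (by positivity)]
    exact ENNReal.ofReal_le_ofReal (hξ.scale_le c.1 4 (by norm_num) (by norm_num))
  have hsum₂ : ∑' B' : u, ENNReal.ofReal (ξ (B'.1.scale 8 (by norm_num))) ≤
      ENNReal.ofReal (D ^ 3 / τ * η) := by
    rw [ENNReal.ofReal_mul (by positivity)]
    refine (tsum_scale_le_of_disjoint hξ hD hτ hudisj
      (fun B' hB' => (hut hB').1.2.1.trans (min_le_left r₁ _))
      (fun B' hB' => (hut hB').2) hmass).trans ?_
    gcongr
  have htotal := (hcontent r hr (by linarith)).trans (hcover.trans (add_le_add hsum₁ hsum₂))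
  rw [← ENNReal.ofReal_add (by positivity) (by positivity),
    ENNReal.ofReal_le_ofReal_iff (by positivity)] at htotal
  have e : D ^ 3 / τ * η = Δ * ξ B / 4 := by rw [hη]; field_simp
  have hD4 : D ^ 4 * τ ≤ D ^ 8 * τ := by gcongr; norm_num
  have h₅ : D ^ 4 * τ * ξ B ≤ Δ / 2 * ξ B := by gcongr; exact hD4.trans hτD
  -- The two parts of the cover cost at most 1/2 + 1/4 < 1 times `Δ * ξ B`.
  nlinarith [mul_pos hΔ hξB]

/-- A sequence of balls, each contained in half of the previous one and of at most half its
radius, has radii tending to `0` and a point of its limsup set common to all the half balls. -/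
theorem exists_mem_limsupBalls_of_nested [CompleteSpace X] {𝓑 : Set (MBall X)} (B : ℕ → MBall X)
    (hmem : ∀ n, B n ∈ 𝓑)
    (hsub : ∀ n, (B (n + 1)).closedSet ⊆ (B n).scaledClosedSet (1 / 2))
    (hrad : ∀ n, (B (n + 1)).radius ≤ (B n).radius / 2) :
    Tendsto (fun n => (B n).radius) atTop (𝓝 0) ∧
      ∃ x ∈ limsupBalls (restrictBalls 𝓑 (B 0).radius (B 0).closedSet),
        ∀ n, x ∈ (B n).scaledClosedSet (1 / 2) := by
  have hgeom : ∀ n, (B n).radius ≤ (B 0).radius * (1 / 2) ^ n := by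
    intro n
    induction n with
    | zero => simp
    | succ n ih =>
      rw [pow_succ]
      linarith [hrad n]
  have hlim : Tendsto (fun n => (B n).radius) atTop (𝓝 0) := by
    refine squeeze_zero (fun n => (B n).radius_pos.le) hgeom ?_
    simpa using (tendsto_pow_atTop_nhds_zero_of_lt_one (r := (1 / 2 : ℝ)) (by norm_num)
      (by norm_num)).const_mul (B 0).radius
  have hstrict : StrictAnti fun n => (B n).radius :=
    strictAnti_nat_of_succ_lt fun n => by linarith [hrad n, (B n).radius_pos]
  have hanti : Antitone fun n => (B n).closedSet :=
    antitone_nat_of_succ_le fun n => (hsub n).trans (B n).scaledClosedSet_half_subset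
  obtain ⟨x, hx⟩ : (⋂ n, (B n).closedSet).Nonempty := by
    refine Metric.nonempty_iInter_of_nonempty_biInter (fun n => Metric.isClosed_closedBall)
      (fun n => Metric.isBounded_closedBall) (fun N => ⟨(B N).center, ?_⟩) ?_
    · exact mem_iInter₂.2 fun n hn =>
        hanti hn (Metric.mem_closedBall_self (B N).radius_pos.le)
    · refine squeeze_zero (fun n => Metric.diam_nonneg)
        (fun n => Metric.diam_closedBall (B n).radius_pos.le) ?_
      simpa using hlim.const_mul 2
  rw [mem_iInter] at hx
  refine ⟨hlim, x, ⟨B, ?_, ?_, hx, hlim⟩, fun n => hsub n (hx (n + 1))⟩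
  · exact fun m n h => hstrict.injective (congrArg MBall.radius h)
  · exact fun n => ⟨hmem n, hstrict.antitone (Nat.zero_le n), hanti (Nat.zero_le n)⟩

end Content

/-! ### The main theorem -/

theorem theorem1p2 (D : ℝ) :
    ∃ β : ℝ, 0 < β ∧
      ∀ Δ : ℝ, 0 < Δ → Δ < 1 →
      ∀ (X : Type u) [MetricSpace X] [CompleteSpace X] (ξ : MBall X → ℝ),
        IsDoublingGauge D ξ →
      ∀ 𝓑 : Set (MBall X),
        (∀ B₀ ∈ 𝓑, ∀ r : ℝ, 0 < r → r ≤ B₀.radius →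
          ENNReal.ofReal (Δ * ξ B₀) ≤
            hausdorffContent ξ B₀.radius
              (unionBalls (restrictBalls 𝓑 r (B₀.scaledClosedSet (1 / 2))))) →
        ∀ B₀ ∈ 𝓑,
          ENNReal.ofReal (Δ * β * ξ B₀) ≤
            hausdorffContent ξ B₀.radius
              (limsupBalls (restrictBalls 𝓑 B₀.radius B₀.closedSet)) := by
  -- The maximum keeps the constant positive for every `D`; once a ball exists, `D ≥ 1`. The
  -- exponent 8 comes from `IsDoublingGauge.le_of_meets`.
  refine ⟨1 / (2 * (max D 1) ^ 8), by positivity, ?_⟩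
  intro Δ hΔ hΔ1 X _ _ ξ hξ 𝓑 hcontent B₀ hB₀
  have hD := hξ.one_le B₀
  rw [max_eq_left hD]
  set τ := Δ * (1 / (2 * D ^ 8)) with hτdef
  have hτ : 0 < τ := by positivity
  have hτD : D ^ 8 * τ ≤ Δ / 2 := by
    rw [hτdef]
    exact le_of_eq (by field_simp)
  by_contra! hlt
  obtain ⟨_, ⟨𝒞, hrad, hcov, rfl⟩, hsum⟩ := sInf_lt_iff.1 hlt
  have hstart : SparselyCovered ξ 𝒞 τ B₀ :=
    ⟨fun c hc => hrad c hc.1,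
      (ENNReal.tsum_mono_subtype (fun c => ENNReal.ofReal (ξ c)) fun _ hc => hc.1).trans hsum.le⟩
  have step : ∀ B : {B // B ∈ 𝓑 ∧ SparselyCovered ξ 𝒞 τ B},
      ∃ B' : {B // B ∈ 𝓑 ∧ SparselyCovered ξ 𝒞 τ B},
        B'.1.closedSet ⊆ B.1.scaledClosedSet (1 / 2) ∧ B'.1.radius ≤ B.1.radius / 2 := by
    rintro ⟨B, hB, hsp⟩
    obtain ⟨B', h₁, h₂, h₃, h₄⟩ := hsp.exists_smaller hξ hΔ hΔ1 hτ hτD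
      hsum.ne_top (hcontent B hB)
    exact ⟨⟨B', h₁, h₄⟩, h₂, h₃⟩
  choose next hnext using step
  let seq : ℕ → {B // B ∈ 𝓑 ∧ SparselyCovered ξ 𝒞 τ B} := fun n => next^[n] ⟨B₀, hB₀, hstart⟩
  have hseq : ∀ n, seq (n + 1) = next (seq n) := fun n => Function.iterate_succ_apply' next n _
  obtain ⟨hlim, x, hx, hxhalf⟩ := exists_mem_limsupBalls_of_nested (fun n => (seq n).1)
    (fun n => (seq n).2.1) (fun n => by rw [hseq]; exact (hnext _).1)
    (fun n => by rw [hseq]; exact (hnext _).2)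
  obtain ⟨c, hc, hxc⟩ := mem_iUnion₂.1 (hcov hx)
  have hle : ∀ n, c.radius ≤ (seq n).1.radius :=
    fun n => (seq n).2.2.1 c ⟨hc, x, hxc, hxhalf n⟩
  exact absurd (ge_of_tendsto' hlim hle) (not_le.2 c.radius_pos)
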